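/- For a finite sequence of nonzero integers $s_1,\dots,s_d$ let $$\zeta(s_1,\dots,s_d)=\lim_{N\to\infty}\ \sum_{N\ge n_1>\cdots>n_d\ge 1}\ \prod_{j=1}^d \frac{\operatorname{sgn}(s_j)^{n_j}}{n_j^{|s_j|}}$$ whenever the limit exists; write $\bar 1$ for the entry $-1$ and $\{1\}_r$ for $r$ consecutive entries equal to $1$. For integers $n\ge 0$ put $$I(n)=\int_0^1\frac{\ln^n(1+x)\,\ln(1-x)}{1+x}\,dx,$$ and let $\mathrm{Li}_s(x)=\sum_{n\ge1}x^n/n^s$. All the integrals $I(n)$ exist. For all integers $m,k\ge 0$ the limit defining $\zeta(\bar 1,\{1\}_m,\bar 1,\bar 1,\{1\}_k)$ exists, and $$\zeta(\bar 1,\{1\}_m,\bar 1,\bar 1,\{1\}_k)=\frac{(-1)^k}{(m+1)!\,(k+1)!}\Big\{(k+1)(\ln 2)^{m+1}I(k)-(m+k+2)\,I(m+k+1)\Big\}-\sum_{i=1}^m\frac{(\ln 2)^i}{i!}\,\zeta(\bar 1,\{1\}_{m-i},\bar 1,\bar 1,\{1\}_k).$$ Here $I(0)=\tfrac12\big(\ln^2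 2-\zeta(2)\big)$, and for every integer $n\ge 1$ $$I(n)=\frac{(\ln 2)^{n+2}}{n+1}-\zeta(2)(\ln 2)^n-\sum_{r=1}^n\binom nr(-1)^{r+1}\Big\{\sum_{l=1}^r l!\binom rl(\ln 2)^{n-l}\,\mathrm{Li}_{l+2}\big(\tfrac12\big)-r!\,(\ln 2)^{n-r}\zeta(r+2)\Big\}.$$ Consequently, for all integers $m,k\ge 0$, $\zeta(\bar 1,\{1\}_m,\bar 1,\bar 1,\{1\}_k)$ is a rational linear combination of numbers of the form $(\ln 2)^a$, $(\ln 2)^a\zeta(j)$ and $(\ln 2)^a\,\mathrm{Li}_j(\tfrac12)$ with integers $a\ge 0$ and $j\ge 2$. -/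

import Mathlib

open Filter Topology

/-- The truncated alternating multiple zeta value (multiple harmonic number)
`ζ_n(s₁, …, s_k) = ∑_{n ≥ n₁ > n₂ > ⋯ > n_k ≥ 1} ∏ j, sgn(s_j) ^ n_j * n_j ^ (-|s_j|)`,
written as a nested sum: the summation variable `n₁ = j` runs over `1, …, n` and the remaining
variables run below it. The value at the empty index is `1`. A barred entry is a negative one. -/
noncomputable def mzvPartial : List ℤ → ℕ → ℝ
  | [], _ => 1
  | a :: s, n =>
      ∑ j ∈ Finset.Icc 1 n, ((Int.sign a : ℤ) : ℝ) ^ j / (j : ℝ) ^ a.natAbs * mzvPartial s (j - 1)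

/-- The alternating multiple zeta value `ζ(s₁, …, s_k)`, the (in general only conditionally
convergent) sum over `n₁ > ⋯ > n_k > 0`: the limit of the truncated sums. -/
noncomputable def mzv (s : List ℤ) : ℝ :=
  limUnder atTop (mzvPartial s)

/-- The index `(1̄, {1}_m, 1̄, 1̄, {1}_k)`. -/
def barIndex (m k : ℕ) : List ℤ :=
  [-1] ++ List.replicate m 1 ++ [-1, -1] ++ List.replicate k 1

/-- The integrand `ln^n(1+x) ln(1-x) / (1+x)`. -/
noncomputable def logIntegrand (n : ℕ) (x : ℝ) : ℝ :=
  Real.log (1 + x) ^ n * Real.log (1 - x) / (1 + x)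

/-- `I(n) = ∫_0^1 ln^n(1+x) ln(1-x) / (1+x) dx`. -/
noncomputable def logIntegral (n : ℕ) : ℝ :=
  ∫ x in (0 : ℝ)..1, logIntegrand n x

/-- The polylogarithm `Li_s(x) = ∑_{n ≥ 1} x^n / n^s` at a natural number `s`. -/
noncomputable def polyLog (s : ℕ) (x : ℝ) : ℝ :=
  ∑' n : ℕ, x ^ (n + 1) / ((n : ℝ) + 1) ^ s

/-- The value of the Riemann zeta function at a natural number `s ≥ 2`, as a real number. -/
noncomputable def zetaVal (s : ℕ) : ℝ :=
  (riemannZeta (s : ℂ)).re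

/-- The real numbers `(ln 2)^a`, `(ln 2)^a ζ(j)` and `(ln 2)^a Li_j(1/2)` with `a ≥ 0`, `j ≥ 2`. -/
def zetaPolylogTerms : Set ℝ :=
  {x | ∃ a : ℕ, x = Real.log 2 ^ a ∨
    ∃ j : ℕ, 2 ≤ j ∧
      (x = Real.log 2 ^ a * zetaVal j ∨ x = Real.log 2 ^ a * polyLog j (1 / 2))}

open Filter Topology

/-! ### Truncated sums with entries `±1` -/

/-! The increments of the truncated sums have a generating function `mzvGen`, an iterated integral:
removing the head entry a is differentiation, with derivative a · mzvGen s (a x) / (1 - a x). Each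
entry -1 reflects x to -x. Write L = ln(1 + x), G_m for the generating function of `barIndex m k`,
and H_m for that of `innerIndex m k` at -x. Then G_m' = -H_m / (1 + x) and H_{m+1} = G_m, so the
derivative of ∑ L^i / i! · G_{m-i} telescopes to -L^m / m! · H_0 / (1 + x). Since H_0 is explicit up
to the primitive of `logIntegrand k`, this sum has a closed form on |x| < 1
(`sum_log_pow_mul_mzvGen`). Letting x tend to 1 from below gives the recurrence. The left side is
handled by Abel's theorem, which needs the series to converge: the inner sums grow at most like √n,
and the leading entry -1 supplies the alternating sign (`tendsto_mzvPartial_neg_one_cons`). For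
I(n), the identity ln(1 - x) = ln 2 - Li_1((1 + x)/2) and repeated integration by parts give an
explicit primitive, hence a single-sum formula (`logIntegral_eq`). The double sum over binomials
collapses to it by orthogonality of binomial coefficients. The rational span statement follows by
strong induction on m. -/

lemma mzvPartial_cons_zero (a : ℤ) (s : List ℤ) : mzvPartial (a :: s) 0 = 0 := by
  simp [mzvPartial]

lemma mzvPartial_cons_succ (a : ℤ) (s : List ℤ) (n : ℕ) :
    mzvPartial (a :: s) (n + 1) = mzvPartial (a :: s) n +
      ((Int.sign a : ℤ) : ℝ) ^ (n + 1) / ((n : ℝ) + 1) ^ a.natAbs * mzvPartial s n := by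
  simp only [mzvPartial]
  rw [Finset.sum_Icc_succ_top (by omega)]
  simp

/-- All entries of the index are `1` or `-1`. -/
def IsUnitIndex (s : List ℤ) : Prop := ∀ a ∈ s, a = 1 ∨ a = -1

lemma IsUnitIndex.tail {a : ℤ} {s : List ℤ} (h : IsUnitIndex (a :: s)) : IsUnitIndex s :=
  fun b hb => h b (List.mem_cons_of_mem a hb)

lemma IsUnitIndex.head {a : ℤ} {s : List ℤ} (h : IsUnitIndex (a :: s)) : a = 1 ∨ a = -1 :=
  h a List.mem_cons_self

lemma mzvPartial_unit_succ {a : ℤ} (ha : a = 1 ∨ a = -1) (s : List ℤ) (n : ℕ) :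
    mzvPartial (a :: s) (n + 1) = mzvPartial (a :: s) n +
      (a : ℝ) ^ (n + 1) / ((n : ℝ) + 1) * mzvPartial s n := by
  rw [mzvPartial_cons_succ]
  rcases ha with rfl | rfl <;> simp

/-- Bounding every sign by 1 and every inner sum by its value at the top index leaves a product of
harmonic numbers. -/
lemma abs_mzvPartial_le_harmonic_pow {s : List ℤ} (hs : IsUnitIndex s) (n : ℕ) :
    |mzvPartial s n| ≤ (harmonic n : ℝ) ^ s.length := by
  induction s generalizing n with
  | nil => simp [mzvPartial]
  | cons a s ih =>
    have mono : ∀ k : ℕ, (0 : ℝ) ≤ harmonic k := fun k => by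
      rw [harmonic]; push_cast; exact Finset.sum_nonneg fun i _ => by positivity
    induction n with
    | zero => rw [mzvPartial_cons_zero]; simp
    | succ n ihn =>
      rw [mzvPartial_unit_succ hs.head]
      have h1 : |(a : ℝ) ^ (n + 1)| = 1 := by
        rcases hs.head with rfl | rfl <;> simp
      have h2 : |(a : ℝ) ^ (n + 1) / ((n : ℝ) + 1) * mzvPartial s n|
          ≤ 1 / ((n : ℝ) + 1) * (harmonic n : ℝ) ^ s.length := by
        rw [abs_mul, abs_div, h1, abs_of_pos (by positivity : (0 : ℝ) < (n : ℝ) + 1)]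
        gcongr
        exact ih hs.tail n
      have h3 : (harmonic (n + 1) : ℝ) = harmonic n + 1 / ((n : ℝ) + 1) := by
        rw [harmonic_succ]; push_cast; simp
      have h4 : (harmonic n : ℝ) ≤ harmonic (n + 1) := by
        rw [h3]; linarith [show (0 : ℝ) ≤ 1 / ((n : ℝ) + 1) by positivity]
      calc _ ≤ _ := abs_add_le _ _
        _ ≤ (harmonic n : ℝ) ^ (s.length + 1) + 1 / ((n : ℝ) + 1) * (harmonic n : ℝ) ^ s.length :=
          add_le_add ihn h2
        _ = harmonic (n + 1) * (harmonic n : ℝ) ^ s.length := by rw [h3]; ring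
        _ ≤ harmonic (n + 1) * (harmonic (n + 1) : ℝ) ^ s.length := by
          have := mono n
          have := mono (n + 1)
          gcongr
        _ = _ := by rw [List.length_cons]; ring

/-- Powers of the logarithm grow slower than any positive power; exponent 1/2 is enough for the
convergence arguments below. -/
lemma exists_abs_mzvPartial_le_sqrt {s : List ℤ} (hs : IsUnitIndex s) :
    ∃ C : ℝ, 0 ≤ C ∧ ∀ n : ℕ, |mzvPartial s n| ≤ C * √((n : ℝ) + 1) := by
  set d := s.length with hd
  -- Chosen so that ε d ≤ 1/2, as the d-th power of the harmonic bound requires.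
  set ε : ℝ := 1 / (2 * ((d : ℝ) + 1)) with hε
  have hε0 : 0 < ε := by positivity
  refine ⟨(1 + 1 / ε) ^ d, by positivity, fun n => ?_⟩
  have hx : (1 : ℝ) ≤ (n : ℝ) + 1 := by linarith [Nat.cast_nonneg (α := ℝ) n]
  have h0 : (0 : ℝ) ≤ harmonic n := by
    rw [harmonic]; push_cast; exact Finset.sum_nonneg fun i _ => by positivity
  have h1 : (harmonic n : ℝ) ≤ (1 + 1 / ε) * ((n : ℝ) + 1) ^ ε := by
    have a1 := harmonic_le_one_add_log n
    have a2 : Real.log n ≤ Real.log ((n : ℝ) + 1) := by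
      rcases Nat.eq_zero_or_pos n with rfl | hn
      · simp
      · exact Real.log_le_log (by exact_mod_cast hn) (by linarith)
    have a3 := Real.log_le_rpow_div (by linarith : (0 : ℝ) ≤ (n : ℝ) + 1) hε0
    have a4 := Real.one_le_rpow hx hε0.le
    calc (harmonic n : ℝ) ≤ ((n : ℝ) + 1) ^ ε + ((n : ℝ) + 1) ^ ε / ε := by linarith
      _ = _ := by ring
  calc |mzvPartial s n| ≤ (harmonic n : ℝ) ^ d := abs_mzvPartial_le_harmonic_pow hs n
    _ ≤ ((1 + 1 / ε) * ((n : ℝ) + 1) ^ ε) ^ d := by gcongr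
    _ = (1 + 1 / ε) ^ d * ((n : ℝ) + 1) ^ (ε * d) := by
      rw [mul_pow, Real.rpow_mul_natCast (by linarith)]
    _ ≤ (1 + 1 / ε) ^ d * √((n : ℝ) + 1) := by
      rw [Real.sqrt_eq_rpow]
      refine mul_le_mul_of_nonneg_left (Real.rpow_le_rpow_of_exponent_le hx ?_) (by positivity)
      rw [hε, div_mul_eq_mul_div, div_le_div_iff₀ (by positivity) (by norm_num)]
      linarith

lemma summable_abs_mzvPartial_mul_pow {s : List ℤ} (hs : IsUnitIndex s) {r : ℝ} (h0 : 0 ≤ r)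
    (h1 : r < 1) : Summable fun n : ℕ => |mzvPartial s n| * r ^ n := by
  obtain ⟨C, hC, h⟩ := exists_abs_mzvPartial_le_sqrt hs
  have hr : ‖r‖ < 1 := by rwa [Real.norm_of_nonneg h0]
  have hsum : Summable fun n : ℕ => C * ((n : ℝ) ^ 1 * r ^ n + r ^ n) :=
    ((summable_pow_mul_geometric_of_norm_lt_one 1 hr).add
      (summable_geometric_of_norm_lt_one hr)).mul_left C
  refine Summable.of_nonneg_of_le (fun n => by positivity) (fun n => ?_) hsum
  have h2 : √((n : ℝ) + 1) ≤ (n : ℝ) + 1 :=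
    Real.sqrt_le_iff.2 ⟨by positivity, by nlinarith [Nat.cast_nonneg (α := ℝ) n]⟩
  calc |mzvPartial s n| * r ^ n ≤ (C * ((n : ℝ) + 1)) * r ^ n := by
        gcongr; exact (h n).trans (by gcongr)
    _ = _ := by ring

lemma summable_mzvPartial_mul_pow {s : List ℤ} (hs : IsUnitIndex s) {x : ℝ} (hx : |x| < 1) :
    Summable fun n : ℕ => mzvPartial s n * x ^ n := by
  refine Summable.of_norm ?_
  simpa [abs_mul, abs_pow] using summable_abs_mzvPartial_mul_pow hs (abs_nonneg x) hx

/-! ### Generating functions -/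

/-- The generating function `∑ (p n - p (n - 1)) x ^ n` of the increments of `p = mzvPartial s`. -/
noncomputable def mzvGen (s : List ℤ) (x : ℝ) : ℝ :=
  (1 - x) * ∑' n : ℕ, mzvPartial s n * x ^ n

lemma mzvGen_nil {x : ℝ} (hx : |x| < 1) : mzvGen [] x = 1 := by
  have h : 1 - x ≠ 0 := by linarith [(abs_lt.1 hx).2]
  simp [mzvGen, mzvPartial, tsum_geometric_of_abs_lt_one hx, h]

lemma mzvGen_cons {a : ℤ} {s : List ℤ} (hs : IsUnitIndex (a :: s)) {x : ℝ} (hx : |x| < 1) :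
    mzvGen (a :: s) x =
      ∑' n : ℕ, (a : ℝ) ^ (n + 1) / ((n : ℝ) + 1) * mzvPartial s n * x ^ (n + 1) := by
  have h := summable_mzvPartial_mul_pow hs hx
  have h' := (summable_nat_add_iff 1).2 h
  rw [mzvGen, sub_mul, one_mul]
  nth_rw 1 [h.tsum_eq_zero_add]
  rw [mzvPartial_cons_zero, zero_mul, zero_add, ← tsum_mul_left, ← h'.tsum_sub (h.mul_left x)]
  refine tsum_congr fun n => ?_
  rw [mzvPartial_unit_succ hs.head]
  ring

lemma mzvGen_cons_zero (a : ℤ) (s : List ℤ) : mzvGen (a :: s) 0 = 0 := by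
  rw [mzvGen, tsum_eq_single 0 (fun n hn => by simp [hn])]
  simp [mzvPartial_cons_zero]

/-- Termwise differentiation cancels the denominator n + 1 and leaves a power series in a x, which
is `mzvGen s` without its factor 1 - a x. -/
lemma hasDerivAt_mzvGen_cons {a : ℤ} {s : List ℤ} (hs : IsUnitIndex (a :: s)) {x : ℝ}
    (hx : |x| < 1) :
    HasDerivAt (mzvGen (a :: s)) (a * mzvGen s (a * x) / (1 - a * x)) x := by
  obtain ⟨r, hxr, hr1⟩ := exists_between hx
  have hr0 : 0 ≤ r := (abs_nonneg x).trans hxr.le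
  have habs : |(a : ℝ)| = 1 := by rcases hs.head with rfl | rfl <;> simp
  have key : HasDerivAt
      (fun y : ℝ => ∑' n : ℕ, (a : ℝ) ^ (n + 1) / ((n : ℝ) + 1) * mzvPartial s n * y ^ (n + 1))
      (∑' n : ℕ, (a : ℝ) ^ (n + 1) * mzvPartial s n * x ^ n) x := by
    refine hasDerivAt_tsum_of_isPreconnected (t := Set.Ioo (-r) r) (y₀ := 0)
      (summable_abs_mzvPartial_mul_pow hs.tail hr0 hr1) isOpen_Ioo isPreconnected_Ioo
      (g' := fun (n : ℕ) (y : ℝ) => (a : ℝ) ^ (n + 1) * mzvPartial s n * y ^ n)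
      (fun n y _ => ?_) (fun n y hy => ?_) ?_ ?_ (abs_lt.1 hxr)
    · have h := (hasDerivAt_pow (n + 1) y).const_mul
        ((a : ℝ) ^ (n + 1) / ((n : ℝ) + 1) * mzvPartial s n)
      refine h.congr_deriv ?_
      have : (n : ℝ) + 1 ≠ 0 := by positivity
      push_cast
      field_simp
    · have hy' : |y| ≤ r := (abs_lt.2 hy).le
      rw [Real.norm_eq_abs, abs_mul, abs_mul, abs_pow, abs_pow, habs, one_pow, one_mul]
      gcongr
    · have : 0 < r := (abs_nonneg x).trans_lt hxr
      constructor <;> linarith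
    · simp
  have hev : mzvGen (a :: s) =ᶠ[𝓝 x] fun y : ℝ =>
      ∑' n : ℕ, (a : ℝ) ^ (n + 1) / ((n : ℝ) + 1) * mzvPartial s n * y ^ (n + 1) := by
    filter_upwards [isOpen_Ioo.mem_nhds (abs_lt.1 hx)] with y hy
    exact mzvGen_cons hs (abs_lt.2 hy)
  refine (key.congr_of_eventuallyEq hev).congr_deriv ?_
  have hax : |(a : ℝ) * x| < 1 := by rwa [abs_mul, habs, one_mul]
  have hne : 1 - (a : ℝ) * x ≠ 0 := by linarith [(abs_lt.1 hax).2]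
  rw [mzvGen, mul_left_comm, mul_div_cancel_left₀ _ hne, ← tsum_mul_left]
  exact tsum_congr fun n => by ring

/-! ### Convergence and Abel summation -/

/-- Summation by parts: twice the alternating sum is a boundary term minus an absolutely convergent
alternating sum of differences. -/
lemma exists_tendsto_alternating_of_summable_sub {u : ℕ → ℝ} (hu : Tendsto u atTop (𝓝 0))
    (hsum : Summable fun n => |u (n + 1) - u n|) :
    ∃ l, Tendsto (fun N => ∑ n ∈ Finset.range N, (-1 : ℝ) ^ n * u n) atTop (𝓝 l) := by
  have hid : ∀ N, ∑ n ∈ Finset.range N, (-1 : ℝ) ^ n * u n =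
      (u 0 - (-1) ^ N * u N - ∑ n ∈ Finset.range N, (-1 : ℝ) ^ n * (u (n + 1) - u n)) / 2 := by
    intro N
    induction N with
    | zero => simp
    | succ N ih => rw [Finset.sum_range_succ, Finset.sum_range_succ, ih]; ring
  have h1 : Summable fun n => (-1 : ℝ) ^ n * (u (n + 1) - u n) :=
    Summable.of_norm (by simpa [abs_mul] using hsum)
  have h2 : Tendsto (fun N => (-1 : ℝ) ^ N * u N) atTop (𝓝 0) := by
    rw [tendsto_zero_iff_abs_tendsto_zero] at hu ⊢
    simpa [Function.comp_def, abs_mul] using hu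
  simp_rw [hid]
  exact ⟨_, ((tendsto_const_nhds.sub h2).sub h1.hasSum.tendsto_sum_nat).div_const 2⟩

lemma mzvPartial_neg_one_cons (s : List ℤ) (n : ℕ) :
    mzvPartial (-1 :: s) n =
      -∑ i ∈ Finset.range n, (-1 : ℝ) ^ i * (mzvPartial s i / ((i : ℝ) + 1)) := by
  induction n with
  | zero => rw [mzvPartial_cons_zero]; simp
  | succ n ih =>
    rw [mzvPartial_unit_succ (Or.inr rfl), ih, Finset.sum_range_succ]
    push_cast
    ring

lemma summable_sqrt_div_sq : Summable fun n : ℕ => √((n : ℝ) + 1) / ((n : ℝ) + 1) ^ 2 := by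
  have h := (summable_nat_add_iff 1).2 (Real.summable_nat_rpow_inv.2 (by norm_num : (1 : ℝ) < 3 / 2))
  refine h.congr fun n => ?_
  have hp : (0 : ℝ) < (n : ℝ) + 1 := by positivity
  push_cast
  rw [Real.sqrt_eq_rpow, ← Real.rpow_natCast, ← Real.rpow_sub hp, ← Real.rpow_neg hp.le]
  norm_num

lemma tendsto_mzvPartial_neg_one_cons {a : ℤ} {s : List ℤ} (hs : IsUnitIndex (a :: s)) :
    Tendsto (mzvPartial (-1 :: a :: s)) atTop (𝓝 (mzv (-1 :: a :: s))) := by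
  obtain ⟨C, hC, hp⟩ := exists_abs_mzvPartial_le_sqrt hs
  obtain ⟨D, hD, hq⟩ := exists_abs_mzvPartial_le_sqrt hs.tail
  have hu : Tendsto (fun n : ℕ => mzvPartial (a :: s) n / ((n : ℝ) + 1)) atTop (𝓝 0) := by
    have hlim : Tendsto (fun n : ℕ => C * (√((n : ℝ) + 1))⁻¹) atTop (𝓝 0) := by
      have h1 : Tendsto (fun n : ℕ => √((n : ℝ) + 1)) atTop atTop :=
        Real.tendsto_sqrt_atTop.comp
          (tendsto_atTop_add_const_right _ _ tendsto_natCast_atTop_atTop)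
      simpa using h1.inv_tendsto_atTop.const_mul C
    refine squeeze_zero_norm (fun n => ?_) hlim
    have hpos : (0 : ℝ) < (n : ℝ) + 1 := by positivity
    rw [Real.norm_eq_abs, abs_div, abs_of_pos hpos, div_le_iff₀ hpos]
    refine (hp n).trans_eq ?_
    have h2 : √((n : ℝ) + 1) * √((n : ℝ) + 1) = (n : ℝ) + 1 := Real.mul_self_sqrt hpos.le
    have h3 : √((n : ℝ) + 1) ≠ 0 := (Real.sqrt_pos.2 hpos).ne'
    nth_rw 3 [← h2]
    field_simp
  have hd : Summable fun n : ℕ => |mzvPartial (a :: s) (n + 1) / (((n + 1 : ℕ) : ℝ) + 1)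
      - mzvPartial (a :: s) n / ((n : ℝ) + 1)| := by
    refine Summable.of_nonneg_of_le (fun n => abs_nonneg _) (fun n => ?_)
      (summable_sqrt_div_sq.mul_left (D + C))
    have hpos : (0 : ℝ) < (n : ℝ) + 1 := by positivity
    have hpos' : (0 : ℝ) < (n : ℝ) + 2 := by positivity
    have habs : |(a : ℝ) ^ (n + 1)| = 1 := by rcases hs.head with rfl | rfl <;> simp
    -- Each difference is a numerator of size O(√n) over a quadratic denominator, hence summable.
    have e1 : mzvPartial (a :: s) (n + 1) / (((n + 1 : ℕ) : ℝ) + 1)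
        - mzvPartial (a :: s) n / ((n : ℝ) + 1) =
        ((a : ℝ) ^ (n + 1) * mzvPartial s n - mzvPartial (a :: s) n)
          / (((n : ℝ) + 1) * ((n : ℝ) + 2)) := by
      rw [mzvPartial_unit_succ hs.head]
      push_cast
      rw [show (n : ℝ) + 1 + 1 = n + 2 by ring]
      field_simp
      ring
    have e2 : |(a : ℝ) ^ (n + 1) * mzvPartial s n - mzvPartial (a :: s) n|
        ≤ (D + C) * √((n : ℝ) + 1) := by
      refine (abs_sub _ _).trans ?_
      rw [abs_mul, habs, one_mul, add_mul]
      exact add_le_add (hq n) (hp n)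
    rw [e1, abs_div, abs_of_pos (mul_pos hpos hpos'), ← mul_div_assoc]
    refine div_le_div₀ (by positivity) e2 (by positivity) ?_
    nlinarith
  obtain ⟨l, hl⟩ := exists_tendsto_alternating_of_summable_sub hu hd
  refine tendsto_nhds_limUnder ⟨-l, ?_⟩
  simpa only [← mzvPartial_neg_one_cons] using hl.neg

lemma tendsto_mzvGen_neg_one_cons {a : ℤ} {s : List ℤ} (hs : IsUnitIndex (a :: s)) :
    Tendsto (mzvGen (-1 :: a :: s)) (𝓝[<] 1) (𝓝 (mzv (-1 :: a :: s))) := by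
  have hs' : IsUnitIndex (-1 :: a :: s) := by
    intro b hb
    rcases List.mem_cons.1 hb with rfl | hb
    · exact Or.inr rfl
    · exact hs b hb
  have h := tendsto_mzvPartial_neg_one_cons hs
  have hsum : mzvPartial (-1 :: a :: s) = fun n => ∑ i ∈ Finset.range n,
      ((-1 : ℤ) : ℝ) ^ (i + 1) / ((i : ℝ) + 1) * mzvPartial (a :: s) i := by
    funext n
    rw [mzvPartial_neg_one_cons, ← Finset.sum_neg_distrib]
    refine Finset.sum_congr rfl fun i _ => ?_
    push_cast
    ring
  have habel := Real.tendsto_tsum_powerSeries_nhdsWithin_lt (hsum ▸ h)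
  -- Abel's theorem yields a series in x^n, whereas `mzvGen_cons` has x^(n + 1); the extra factor x
  -- tends to 1.
  have hid : Tendsto (fun x : ℝ => x) (𝓝[<] 1) (𝓝 1) := nhdsWithin_le_nhds
  have hmul := hid.mul habel
  rw [one_mul] at hmul
  refine hmul.congr' ?_
  filter_upwards [Ioo_mem_nhdsLT (show (0 : ℝ) < 1 by norm_num)] with x hx
  rw [mzvGen_cons hs' (abs_lt.2 ⟨by linarith [hx.1], hx.2⟩), ← tsum_mul_left]
  exact tsum_congr fun n => by ring

/-! ### The logarithmic integrals -/

lemma eq_of_hasDerivAt_eq_of_abs_lt_one {f g f' : ℝ → ℝ}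
    (hf : ∀ x : ℝ, |x| < 1 → HasDerivAt f (f' x) x)
    (hg : ∀ x : ℝ, |x| < 1 → HasDerivAt g (f' x) x) (h0 : f 0 = g 0) {x : ℝ} (hx : |x| < 1) :
    f x = g x := by
  refine isOpen_Ioo.eqOn_of_deriv_eq (s := Set.Ioo (-1 : ℝ) 1) (x := 0) isPreconnected_Ioo
    (fun y hy => (hf y (abs_lt.2 hy)).differentiableAt.differentiableWithinAt)
    (fun y hy => (hg y (abs_lt.2 hy)).differentiableAt.differentiableWithinAt)
    (fun y hy => ?_) (by norm_num) h0 (abs_lt.1 hx)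
  rw [(hf y (abs_lt.2 hy)).deriv, (hg y (abs_lt.2 hy)).deriv]

lemma hasDerivAt_log_one_add {x : ℝ} (hx : |x| < 1) :
    HasDerivAt (fun y : ℝ => Real.log (1 + y)) (1 / (1 + x)) x :=
  ((hasDerivAt_id x).const_add 1).log (by simp only [id]; linarith [(abs_lt.1 hx).1])

lemma hasDerivAt_log_one_sub {x : ℝ} (hx : |x| < 1) :
    HasDerivAt (fun y : ℝ => Real.log (1 - y)) (-1 / (1 - x)) x :=
  ((hasDerivAt_id x).const_sub 1).log (by simp only [id]; linarith [(abs_lt.1 hx).2])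

lemma intervalIntegrable_logIntegrand (n : ℕ) :
    IntervalIntegrable (logIntegrand n) MeasureTheory.volume 0 1 := by
  have h1 : IntervalIntegrable (fun x : ℝ => Real.log (1 - x)) MeasureTheory.volume 0 1 := by
    have := (intervalIntegral.intervalIntegrable_log' (a := 1) (b := 0)).comp_sub_left 1
    simpa using this
  have h2 : ContinuousOn (fun x : ℝ => Real.log (1 + x) ^ n / (1 + x)) (Set.uIcc 0 1) := by
    rw [Set.uIcc_of_le zero_le_one]
    have hne : ∀ x ∈ Set.Icc (0 : ℝ) 1, 1 + x ≠ 0 := fun x hx => by linarith [hx.1]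
    exact ((ContinuousOn.log (by fun_prop) hne).pow n).div (by fun_prop) hne
  refine (h1.mul_continuousOn h2).congr fun x _ => ?_
  rw [logIntegrand]
  ring

lemma continuousOn_logIntegrand (n : ℕ) : ContinuousOn (logIntegrand n) (Set.Ioo (-1) 1) := by
  have h1 : ∀ x ∈ Set.Ioo (-1 : ℝ) 1, 1 + x ≠ 0 := fun x hx => by linarith [hx.1]
  have h2 : ∀ x ∈ Set.Ioo (-1 : ℝ) 1, 1 - x ≠ 0 := fun x hx => by linarith [hx.2]
  exact (((ContinuousOn.log (by fun_prop) h1).pow n).mul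
    (ContinuousOn.log (by fun_prop) h2)).div (by fun_prop) h1

lemma hasDerivAt_integral_logIntegrand (n : ℕ) {x : ℝ} (hx : |x| < 1) :
    HasDerivAt (fun y => ∫ t in (0 : ℝ)..y, logIntegrand n t) (logIntegrand n x) x := by
  have hc := continuousOn_logIntegrand n
  have hx' := abs_lt.1 hx
  refine intervalIntegral.integral_hasDerivAt_right ?_
    (hc.stronglyMeasurableAtFilter isOpen_Ioo x hx') (hc.continuousAt (isOpen_Ioo.mem_nhds hx'))
  refine (hc.mono ?_).intervalIntegrable
  exact (Set.ordConnected_Ioo (a := (-1 : ℝ)) (b := 1)).uIcc_subset (by norm_num) hx'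

lemma tendsto_integral_logIntegrand (n : ℕ) :
    Tendsto (fun y => ∫ t in (0 : ℝ)..y, logIntegrand n t) (𝓝[<] 1) (𝓝 (logIntegral n)) := by
  have h := intervalIntegral.continuousOn_primitive_interval
    ((intervalIntegrable_iff_integrableOn_Icc_of_le zero_le_one).1
      (intervalIntegrable_logIntegrand n) |>.mono_set (by rw [Set.uIcc_of_le zero_le_one]))
  rw [Set.uIcc_of_le zero_le_one] at h
  have h1 := h 1 (by norm_num)
  refine h1.mono_left ?_
  rw [nhdsWithin_Icc_eq_nhdsLE zero_lt_one]
  exact nhdsWithin_mono _ Set.Iio_subset_Iic_self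

/-! ### Generating functions of the indices `(1̄, {1}_m, 1̄, 1̄, {1}_k)` -/

lemma isUnitIndex_replicate_append (m : ℕ) {s : List ℤ} (hs : IsUnitIndex s) :
    IsUnitIndex (List.replicate m 1 ++ s) := by
  intro a ha
  rcases List.mem_append.1 ha with h | h
  · exact Or.inl (List.eq_of_mem_replicate h)
  · exact hs a h

lemma isUnitIndex_replicate (k : ℕ) : IsUnitIndex (List.replicate k 1) :=
  fun _ ha => Or.inl (List.eq_of_mem_replicate ha)

lemma IsUnitIndex.neg_one_cons {s : List ℤ} (hs : IsUnitIndex s) : IsUnitIndex (-1 :: s) := by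
  intro a ha
  rcases List.mem_cons.1 ha with rfl | h
  · exact Or.inr rfl
  · exact hs a h

/-- The index `({1}_j, 1̄, 1̄, {1}_k)`. -/
def innerIndex (j k : ℕ) : List ℤ := List.replicate j 1 ++ -1 :: -1 :: List.replicate k 1

lemma isUnitIndex_innerIndex (j k : ℕ) : IsUnitIndex (innerIndex j k) :=
  isUnitIndex_replicate_append j (isUnitIndex_replicate k).neg_one_cons.neg_one_cons

lemma innerIndex_succ (j k : ℕ) : innerIndex (j + 1) k = 1 :: innerIndex j k := by
  simp [innerIndex, List.replicate_succ]

lemma barIndex_eq (m k : ℕ) : barIndex m k = -1 :: innerIndex m k := by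
  simp [barIndex, innerIndex]

lemma exists_innerIndex_eq_cons (j k : ℕ) : ∃ a s, innerIndex j k = a :: s := by
  cases j with
  | zero => exact ⟨_, _, rfl⟩
  | succ j => exact ⟨_, _, innerIndex_succ j k⟩

lemma tendsto_mzvPartial_barIndex (m k : ℕ) :
    Tendsto (mzvPartial (barIndex m k)) atTop (𝓝 (mzv (barIndex m k))) := by
  obtain ⟨a, s, h⟩ := exists_innerIndex_eq_cons m k
  rw [barIndex_eq, h]
  exact tendsto_mzvPartial_neg_one_cons (h ▸ isUnitIndex_innerIndex m k)

lemma tendsto_mzvGen_barIndex (m k : ℕ) :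
    Tendsto (mzvGen (barIndex m k)) (𝓝[<] 1) (𝓝 (mzv (barIndex m k))) := by
  obtain ⟨a, s, h⟩ := exists_innerIndex_eq_cons m k
  rw [barIndex_eq, h]
  exact tendsto_mzvGen_neg_one_cons (h ▸ isUnitIndex_innerIndex m k)

lemma mzvGen_replicate (k : ℕ) {x : ℝ} (hx : |x| < 1) :
    mzvGen (List.replicate k 1) x = (-Real.log (1 - x)) ^ k / k.factorial := by
  induction k generalizing x with
  | zero => simp [mzvGen_nil hx]
  | succ k ih =>
    rw [List.replicate_succ]
    refine eq_of_hasDerivAt_eq_of_abs_lt_one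
      (f' := fun x => (-Real.log (1 - x)) ^ k / k.factorial / (1 - x))
      (g := fun x => (-Real.log (1 - x)) ^ (k + 1) / (k + 1).factorial)
      (fun y hy => ?_) (fun y hy => ?_) (by simp [mzvGen_cons_zero]) hx
    · refine (hasDerivAt_mzvGen_cons (a := 1) (isUnitIndex_replicate (k + 1)) hy).congr_deriv ?_
      simp [ih hy]
    · refine (((hasDerivAt_log_one_sub hy).neg.pow (k + 1)).div_const _).congr_deriv ?_
      rw [Nat.factorial_succ]
      have : (k : ℝ) + 1 ≠ 0 := by positivity
      push_cast
      simp only [Pi.neg_apply]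
      field_simp

lemma mzvGen_neg_one_cons_replicate (k : ℕ) {x : ℝ} (hx : |x| < 1) :
    mzvGen (-1 :: List.replicate k 1) x =
      (-1) ^ (k + 1) * Real.log (1 + x) ^ (k + 1) / (k + 1).factorial := by
  refine eq_of_hasDerivAt_eq_of_abs_lt_one
    (f' := fun x => (-1) ^ (k + 1) * Real.log (1 + x) ^ k / k.factorial / (1 + x))
    (g := fun x => (-1) ^ (k + 1) * Real.log (1 + x) ^ (k + 1) / (k + 1).factorial)
    (fun y hy => ?_) (fun y hy => ?_) (by simp [mzvGen_cons_zero]) hx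
  · refine (hasDerivAt_mzvGen_cons (isUnitIndex_replicate k).neg_one_cons hy).congr_deriv ?_
    have h := mzvGen_replicate k (x := -y) (by rwa [abs_neg])
    rw [sub_neg_eq_add] at h
    push_cast
    rw [neg_one_mul, neg_one_mul, sub_neg_eq_add, h, neg_pow]
    ring
  · refine ((((hasDerivAt_log_one_add hy).pow (k + 1)).const_mul _).div_const _).congr_deriv ?_
    rw [Nat.factorial_succ]
    have : (k : ℝ) + 1 ≠ 0 := by positivity
    push_cast
    field_simp

/-- Integration by parts of L^(k+1) / (1 - x) with L = ln(1 + x): the boundary term is -L^(k+1) ln(1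
- x), and the remaining integrand is (k + 1) times `logIntegrand k`. -/
lemma mzvGen_innerIndex_zero_neg (k : ℕ) {x : ℝ} (hx : |x| < 1) :
    mzvGen (innerIndex 0 k) (-x) = (-1) ^ (k + 1) / (k + 1).factorial *
      ((k + 1) * (∫ t in (0 : ℝ)..x, logIntegrand k t)
        - Real.log (1 + x) ^ (k + 1) * Real.log (1 - x)) := by
  refine eq_of_hasDerivAt_eq_of_abs_lt_one
    (f' := fun x => (-1) ^ (k + 1) / (k + 1).factorial * (Real.log (1 + x) ^ (k + 1) / (1 - x)))
    (f := fun x => mzvGen (innerIndex 0 k) (-x))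
    (g := fun x => (-1) ^ (k + 1) / (k + 1).factorial *
      ((k + 1) * (∫ t in (0 : ℝ)..x, logIntegrand k t)
        - Real.log (1 + x) ^ (k + 1) * Real.log (1 - x)))
    (fun y hy => ?_) (fun y hy => ?_) (by simp [innerIndex, mzvGen_cons_zero]) hx
  · have hy' : |-y| < 1 := by rwa [abs_neg]
    have h := (hasDerivAt_mzvGen_cons (isUnitIndex_innerIndex 0 k) hy').comp y
      (hasDerivAt_neg y)
    refine h.congr_deriv ?_
    push_cast
    rw [neg_mul_neg, one_mul, mzvGen_neg_one_cons_replicate k hy]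
    ring
  · have h := (((hasDerivAt_integral_logIntegrand k hy).const_mul ((k : ℝ) + 1)).sub
      (((hasDerivAt_log_one_add hy).pow (k + 1)).mul (hasDerivAt_log_one_sub hy))).const_mul
      ((-1 : ℝ) ^ (k + 1) / (k + 1).factorial)
    refine h.congr_deriv ?_
    have h1 : 1 + y ≠ 0 := by linarith [(abs_lt.1 hy).1]
    have h2 : 1 - y ≠ 0 := by linarith [(abs_lt.1 hy).2]
    rw [logIntegrand]
    push_cast
    field_simp
    simp

lemma hasDerivAt_mzvGen_barIndex (m k : ℕ) {x : ℝ} (hx : |x| < 1) :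
    HasDerivAt (mzvGen (barIndex m k)) (-mzvGen (innerIndex m k) (-x) / (1 + x)) x := by
  rw [barIndex_eq]
  refine (hasDerivAt_mzvGen_cons (isUnitIndex_innerIndex m k).neg_one_cons hx).congr_deriv ?_
  simp

/-- A head 1 read at -x and a head -1 read at x produce the same sign (-1)^n, so the reflection
turns one index into the other. -/
lemma mzvGen_innerIndex_succ_neg (j k : ℕ) {x : ℝ} (hx : |x| < 1) :
    mzvGen (innerIndex (j + 1) k) (-x) = mzvGen (barIndex j k) x := by
  refine eq_of_hasDerivAt_eq_of_abs_lt_one (f := fun x => mzvGen (innerIndex (j + 1) k) (-x))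
    (f' := fun x => -mzvGen (innerIndex j k) (-x) / (1 + x))
    (fun y hy => ?_) (fun y hy => hasDerivAt_mzvGen_barIndex j k hy)
    (by simp [innerIndex_succ, barIndex_eq, mzvGen_cons_zero]) hx
  have hy' : |-y| < 1 := by rwa [abs_neg]
  have hi := isUnitIndex_innerIndex (j + 1) k
  rw [innerIndex_succ] at hi ⊢
  refine ((hasDerivAt_mzvGen_cons hi hy').comp y (hasDerivAt_neg y)).congr_deriv ?_
  simp [neg_div]

lemma hasDerivAt_sum_log_pow_mul_mzvGen (m k : ℕ) {x : ℝ} (hx : |x| < 1) :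
    HasDerivAt (fun y => ∑ i ∈ Finset.range (m + 1),
        Real.log (1 + y) ^ i / i.factorial * mzvGen (barIndex (m - i) k) y)
      (-(Real.log (1 + x) ^ m / m.factorial * mzvGen (innerIndex 0 k) (-x) / (1 + x))) x := by
  have h := HasDerivAt.fun_sum (u := Finset.range (m + 1)) fun i _ =>
    (((hasDerivAt_log_one_add hx).pow i).div_const (i.factorial : ℝ)).mul
      (hasDerivAt_mzvGen_barIndex (m - i) k hx)
  refine h.congr_deriv ?_
  -- In each new term, differentiating the power of the logarithm cancels what the previous terms
  -- left over, because H_{j+1} = G_j.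
  have tele : ∀ n ≤ m, ∑ i ∈ Finset.range (n + 1),
      ((i : ℝ) * Real.log (1 + x) ^ (i - 1) * (1 / (1 + x)) / i.factorial *
          mzvGen (barIndex (m - i) k) x +
        Real.log (1 + x) ^ i / i.factorial *
          (-mzvGen (innerIndex (m - i) k) (-x) / (1 + x))) =
      -(Real.log (1 + x) ^ n / n.factorial * mzvGen (innerIndex (m - n) k) (-x) / (1 + x)) := by
    intro n hn
    induction n with
    | zero => simp [neg_div]
    | succ n ih =>
      rw [Finset.sum_range_succ, ih (by omega), show m - n = (m - (n + 1)) + 1 by omega,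
        mzvGen_innerIndex_succ_neg _ _ hx, Nat.factorial_succ]
      have : (n : ℝ) + 1 ≠ 0 := by positivity
      have h1 : 1 + x ≠ 0 := by linarith [(abs_lt.1 hx).1]
      push_cast
      field_simp
      ring
  simpa using tele m le_rfl

lemma sum_log_pow_mul_mzvGen (m k : ℕ) {x : ℝ} (hx : |x| < 1) :
    ∑ i ∈ Finset.range (m + 1),
        Real.log (1 + x) ^ i / i.factorial * mzvGen (barIndex (m - i) k) x =
      (-1) ^ k / ((m + 1).factorial * (k + 1).factorial) *
        ((k + 1) * Real.log (1 + x) ^ (m + 1) * (∫ t in (0 : ℝ)..x, logIntegrand k t)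
          - (m + k + 2) * ∫ t in (0 : ℝ)..x, logIntegrand (m + k + 1) t) := by
  refine eq_of_hasDerivAt_eq_of_abs_lt_one
    (f := fun x => ∑ i ∈ Finset.range (m + 1),
        Real.log (1 + x) ^ i / i.factorial * mzvGen (barIndex (m - i) k) x)
    (g := fun x => (-1) ^ k / ((m + 1).factorial * (k + 1).factorial) *
        ((k + 1) * Real.log (1 + x) ^ (m + 1) * (∫ t in (0 : ℝ)..x, logIntegrand k t)
          - (m + k + 2) * ∫ t in (0 : ℝ)..x, logIntegrand (m + k + 1) t))
    (fun y hy => hasDerivAt_sum_log_pow_mul_mzvGen m k hy) (fun y hy => ?_) ?_ hx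
  · have h := (((((hasDerivAt_log_one_add hy).pow (m + 1)).const_mul ((k : ℝ) + 1)).mul
      (hasDerivAt_integral_logIntegrand k hy)).sub
      ((hasDerivAt_integral_logIntegrand (m + k + 1) hy).const_mul
        ((m : ℝ) + k + 2))).const_mul
      ((-1 : ℝ) ^ k / ((m + 1).factorial * (k + 1).factorial))
    refine h.congr_deriv ?_
    have h1 : 1 + y ≠ 0 := by linarith [(abs_lt.1 hy).1]
    have h2 : (m : ℝ) + 1 ≠ 0 := by positivity
    rw [mzvGen_innerIndex_zero_neg k hy, logIntegrand, logIntegrand, Nat.factorial_succ m,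
      Pi.pow_apply]
    push_cast
    field_simp
    ring
  · simp [barIndex_eq, mzvGen_cons_zero]

lemma sum_log_two_pow_mul_mzv (m k : ℕ) :
    ∑ i ∈ Finset.range (m + 1),
        Real.log 2 ^ i / i.factorial * mzv (barIndex (m - i) k) =
      (-1) ^ k / ((m + 1).factorial * (k + 1).factorial) *
        ((k + 1) * Real.log 2 ^ (m + 1) * logIntegral k
          - (m + k + 2) * logIntegral (m + k + 1)) := by
  have hlog : Tendsto (fun x : ℝ => Real.log (1 + x)) (𝓝[<] 1) (𝓝 (Real.log 2)) := by
    have h : ContinuousAt (fun x : ℝ => Real.log (1 + x)) 1 :=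
      ContinuousAt.log (by fun_prop) (by norm_num)
    have h2 := h.tendsto.mono_left (nhdsWithin_le_nhds (s := Set.Iio 1))
    rwa [one_add_one_eq_two] at h2
  have hl := tendsto_finsetSum (Finset.range (m + 1)) fun i _ =>
    ((hlog.pow i).div_const (i.factorial : ℝ)).mul (tendsto_mzvGen_barIndex (m - i) k)
  have hr := ((((hlog.pow (m + 1)).const_mul ((k : ℝ) + 1)).mul
    (tendsto_integral_logIntegrand k)).sub
    ((tendsto_integral_logIntegrand (m + k + 1)).const_mul ((m : ℝ) + k + 2))).const_mul
    ((-1 : ℝ) ^ k / ((m + 1).factorial * (k + 1).factorial))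
  refine tendsto_nhds_unique (hl.congr' ?_) hr
  filter_upwards [Ioo_mem_nhdsLT (show (0 : ℝ) < 1 by norm_num)] with x hx
  exact sum_log_pow_mul_mzvGen m k (abs_lt.2 ⟨by linarith [hx.1], hx.2⟩)

lemma mzv_barIndex_recurrence (m k : ℕ) :
    mzv (barIndex m k) =
      (-1 : ℝ) ^ k / (((m + 1).factorial : ℝ) * ((k + 1).factorial : ℝ)) *
          (((k : ℝ) + 1) * Real.log 2 ^ (m + 1) * logIntegral k
            - ((m : ℝ) + (k : ℝ) + 2) * logIntegral (m + k + 1))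
        - ∑ i ∈ Finset.Icc 1 m,
            Real.log 2 ^ i / (i.factorial : ℝ) * mzv (barIndex (m - i) k) := by
  rw [← sum_log_two_pow_mul_mzv, Finset.sum_range_eq_add_Ico _ (by omega)]
  simp [Finset.Ico_add_one_right_eq_Icc]

/-! ### Polylogarithms -/

lemma summable_one_div_succ_pow {s : ℕ} (hs : 2 ≤ s) :
    Summable fun n : ℕ => 1 / ((n : ℝ) + 1) ^ s := by
  have h := (summable_nat_add_iff 1).2 (Real.summable_one_div_nat_pow.2 (by omega : 1 < s))
  simpa using h

lemma continuousOn_polyLog {s : ℕ} (hs : 2 ≤ s) : ContinuousOn (polyLog s) (Set.Icc 0 1) := by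
  refine continuousOn_tsum (fun n => by fun_prop) (summable_one_div_succ_pow hs)
    (fun n x hx => ?_)
  have h0 : 0 ≤ x := hx.1
  rw [Real.norm_of_nonneg (by positivity)]
  gcongr
  exact pow_le_one₀ h0 hx.2

lemma hasDerivAt_polyLog_succ (s : ℕ) {x : ℝ} (hx0 : 0 < x) (hx1 : x < 1) :
    HasDerivAt (polyLog (s + 1)) (polyLog s x / x) x := by
  obtain ⟨r, hxr, hr1⟩ := exists_between hx1
  have hr0 : 0 < r := hx0.trans hxr
  have key : HasDerivAt (fun y : ℝ => ∑' n : ℕ, y ^ (n + 1) / ((n : ℝ) + 1) ^ (s + 1))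
      (∑' n : ℕ, x ^ n / ((n : ℝ) + 1) ^ s) x := by
    refine hasDerivAt_tsum_of_isPreconnected (t := Set.Ioo (-r) r) (y₀ := 0)
      (summable_geometric_of_lt_one hr0.le hr1) isOpen_Ioo isPreconnected_Ioo
      (g' := fun (n : ℕ) (y : ℝ) => y ^ n / ((n : ℝ) + 1) ^ s)
      (fun n y _ => ?_) (fun n y hy => ?_) ⟨by linarith, hr0⟩ (by simp) ⟨by linarith, hxr⟩
    · refine ((hasDerivAt_pow (n + 1) y).div_const _).congr_deriv ?_
      have : (n : ℝ) + 1 ≠ 0 := by positivity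
      push_cast
      rw [pow_succ ((n : ℝ) + 1) s]
      field_simp
    · have hy' : |y| ≤ r := (abs_lt.2 hy).le
      have h1 : (1 : ℝ) ≤ ((n : ℝ) + 1) ^ s :=
        one_le_pow₀ (by linarith [Nat.cast_nonneg (α := ℝ) n])
      rw [Real.norm_eq_abs, abs_div, abs_pow, abs_of_pos (zero_lt_one.trans_le h1)]
      exact (div_le_self (by positivity) h1).trans (by gcongr)
  refine key.congr_deriv ?_
  rw [polyLog, ← tsum_div_const]
  refine tsum_congr fun n => ?_
  rw [pow_succ]
  field_simp

lemma polyLog_one {x : ℝ} (hx : |x| < 1) : polyLog 1 x = -Real.log (1 - x) := by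
  simpa [polyLog] using (Real.hasSum_pow_div_log_of_abs_lt_one hx).tsum_eq

lemma polyLog_at_zero (s : ℕ) : polyLog s 0 = 0 := by simp [polyLog]

lemma polyLog_at_one {s : ℕ} (hs : 2 ≤ s) : polyLog s 1 = zetaVal s := by
  have h : Summable fun n : ℕ => 1 / (n : ℝ) ^ s := Real.summable_one_div_nat_pow.2 (by omega)
  have h1 : riemannZeta (s : ℂ) = ((∑' n : ℕ, 1 / (n : ℝ) ^ s : ℝ) : ℂ) := by
    rw [zeta_nat_eq_tsum_of_gt_one (by omega)]
    push_cast
    rfl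
  rw [zetaVal, h1, Complex.ofReal_re, h.tsum_eq_zero_add, polyLog]
  simp [show s ≠ 0 by omega]

/-- Only x = 1 is delicate: the zero of ln x there, extracted by `dslope`, tames ln(1 - x), and the
convention ln 0 = 0 gives the limiting value. -/
lemma continuousOn_log_mul_log_one_sub :
    ContinuousOn (fun x : ℝ => Real.log x * Real.log (1 - x)) (Set.Ioi 0) := by
  have h1 : ContinuousOn (dslope Real.log 1) (Set.Ioi 0) :=
    (continuousOn_dslope (Ioi_mem_nhds one_pos)).2
      ⟨Real.continuousOn_log.mono fun x hx => (ne_of_gt hx : x ≠ 0),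
        Real.differentiableAt_log one_ne_zero⟩
  have h2 : Continuous fun x : ℝ => (1 - x) * Real.log (1 - x) :=
    Real.continuous_mul_log.comp (by fun_prop : Continuous fun x : ℝ => 1 - x)
  refine (h1.mul h2.continuousOn).neg.congr fun x _ => ?_
  have h3 := sub_smul_dslope Real.log 1 x
  rw [Real.log_one, sub_zero, smul_eq_mul] at h3
  simp only [Pi.neg_apply, Pi.mul_apply]
  rw [← h3]
  ring

/-- Euler's reflection formula: Li_2(x) + Li_2(1 - x) + ln x ln(1 - x) has zero derivative, and its
values at 1/2 and 1 are compared. -/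
lemma polyLog_two_half : polyLog 2 (1 / 2) = (zetaVal 2 - Real.log 2 ^ 2) / 2 := by
  have hsub : Set.Icc (1 / 2 : ℝ) 1 ⊆ Set.Icc 0 1 := Set.Icc_subset_Icc_left (by norm_num)
  have hmaps : Set.MapsTo (fun x : ℝ => 1 - x) (Set.Icc (1 / 2) 1) (Set.Icc 0 1) :=
    fun x hx => ⟨by linarith [hx.2], by linarith [hx.1]⟩
  have hcont : ContinuousOn
      (fun x => polyLog 2 x + polyLog 2 (1 - x) + Real.log x * Real.log (1 - x))
      (Set.Icc (1 / 2) 1) :=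
    (((continuousOn_polyLog le_rfl).mono hsub).add
      ((continuousOn_polyLog le_rfl).comp (by fun_prop) hmaps)).add
      (continuousOn_log_mul_log_one_sub.mono fun x hx =>
        (by linarith [hx.1] : (0 : ℝ) < x))
  have hderiv : ∀ x ∈ Set.Ioo (1 / 2 : ℝ) 1, HasDerivAt
      (fun x => polyLog 2 x + polyLog 2 (1 - x) + Real.log x * Real.log (1 - x)) 0 x := by
    intro x hx
    have hx0 : 0 < x := by linarith [hx.1]
    have hx1 : 0 < 1 - x := by linarith [hx.2]
    have d1 : HasDerivAt (fun y : ℝ => 1 - y) (-1) x := (hasDerivAt_id x).const_sub 1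
    have e1 := hasDerivAt_polyLog_succ 1 hx0 hx.2
    have e2 := (hasDerivAt_polyLog_succ 1 hx1 (by linarith)).comp x d1
    have e3 := (Real.hasDerivAt_log hx0.ne').mul (d1.log hx1.ne')
    refine ((e1.add e2).add e3).congr_deriv ?_
    rw [polyLog_one (by rw [abs_of_pos hx0]; exact hx.2),
      polyLog_one (by rw [abs_of_pos hx1]; linarith), sub_sub_cancel]
    field_simp
    ring
  have h := intervalIntegral.integral_eq_sub_of_hasDerivAt_of_le
    (by norm_num : (1 / 2 : ℝ) ≤ 1) hcont hderiv (by simp)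
  have hlog : Real.log (1 / 2) = -Real.log 2 := by simp
  rw [intervalIntegral.integral_zero, sub_self, polyLog_at_zero, polyLog_at_one le_rfl,
    Real.log_one, show (1 : ℝ) - 1 / 2 = 1 / 2 by norm_num, hlog] at h
  linarith

/-! ### Evaluation of the logarithmic integrals -/

lemma logIntegral_eq (n : ℕ) :
    logIntegral n = Real.log 2 ^ (n + 2) / (n + 1)
      - (∑ l ∈ Finset.range (n + 1), (-1) ^ l * (n.descFactorial l : ℝ) *
          (Real.log 2 ^ (n - l) * zetaVal (l + 2)))
      + (-1) ^ n * n.factorial * polyLog (n + 2) (1 / 2) := by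
  -- Primitive from repeated integration by parts: each step lowers the power of the logarithm and
  -- raises the order of the polylogarithm.
  set F : ℝ → ℝ := fun x => Real.log 2 * (Real.log (1 + x) ^ (n + 1) / (n + 1))
      - ∑ l ∈ Finset.range (n + 1), (-1) ^ l * (n.descFactorial l : ℝ) *
          (Real.log (1 + x) ^ (n - l) * polyLog (l + 2) ((1 + x) / 2)) with hF
  have hcont : ContinuousOn F (Set.Icc 0 1) := by
    have hl : ContinuousOn (fun x : ℝ => Real.log (1 + x)) (Set.Icc 0 1) :=
      ContinuousOn.log (by fun_prop) fun x hx => by linarith [hx.1]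
    have hmaps : Set.MapsTo (fun x : ℝ => (1 + x) / 2) (Set.Icc 0 1) (Set.Icc 0 1) :=
      fun x hx => ⟨by linarith [hx.1], by linarith [hx.2]⟩
    refine (((hl.pow (n + 1)).div_const _).const_mul _).sub
      (continuousOn_finsetSum _ fun l _ => ContinuousOn.const_mul ?_ _)
    exact (hl.pow (n - l)).mul
      ((continuousOn_polyLog (by omega : 2 ≤ l + 2)).comp (by fun_prop) hmaps)
  have hderiv : ∀ x ∈ Set.Ioo (0 : ℝ) 1, HasDerivAt F (logIntegrand n x) x := by
    intro x hx
    have hx' : |x| < 1 := abs_lt.2 ⟨by linarith [hx.1], hx.2⟩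
    have hs0 : 0 < (1 + x) / 2 := by linarith [hx.1]
    have hs1 : (1 + x) / 2 < 1 := by linarith [hx.2]
    have hne : 1 + x ≠ 0 := by linarith [hx.1]
    have dl := hasDerivAt_log_one_add hx'
    have ds : HasDerivAt (fun y : ℝ => (1 + y) / 2) (1 / 2) x :=
      ((hasDerivAt_id x).const_add 1).div_const 2
    have h := (((dl.pow (n + 1)).div_const ((n : ℝ) + 1)).const_mul (Real.log 2)).sub
      (HasDerivAt.fun_sum (u := Finset.range (n + 1)) fun l _ =>
        ((dl.pow (n - l)).mul ((hasDerivAt_polyLog_succ (l + 1) hs0 hs1).comp x ds)).const_mul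
          ((-1 : ℝ) ^ l * (n.descFactorial l : ℝ)))
    refine h.congr_deriv ?_
    -- The derivative of the l-th summand is U l - U (l + 1). The sum telescopes to U 0, which
    -- contains Li_1, as the falling factorial kills U (n + 1).
    set U : ℕ → ℝ := fun l => (-1) ^ l * (n.descFactorial l : ℝ) *
      (Real.log (1 + x) ^ (n - l) * polyLog (l + 1) ((1 + x) / 2)) / (1 + x) with hU
    have hsum := Finset.sum_range_sub' U (n + 1)
    have hlog : Real.log (1 - (1 + x) / 2) = Real.log (1 - x) - Real.log 2 := by
      rw [← Real.log_div (by linarith [hx.2]) (by norm_num)]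
      congr 1
      ring
    have hU0 : U 0 = -(Real.log (1 + x) ^ n * (Real.log (1 - x) - Real.log 2) / (1 + x)) := by
      simp only [hU]
      rw [zero_add, polyLog_one (by rwa [abs_of_pos hs0]), hlog]
      simp
      ring
    have hUn : U (n + 1) = 0 := by
      simp [hU]
    rw [hU0, hUn, sub_zero] at hsum
    have hn : (n : ℝ) + 1 ≠ 0 := by positivity
    rw [Finset.sum_congr rfl (g := fun l => U l - U (l + 1)), hsum, logIntegrand]
    · push_cast
      field_simp
      simp
    · intro l _
      simp only [hU, Nat.descFactorial_succ, Pi.pow_apply, Function.comp_apply]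
      rw [← Nat.sub_sub]
      push_cast
      field_simp
      ring
  have h := intervalIntegral.integral_eq_sub_of_hasDerivAt_of_le zero_le_one hcont hderiv
    (intervalIntegrable_logIntegrand n)
  have h1 : F 1 = Real.log 2 ^ (n + 2) / (n + 1)
      - ∑ l ∈ Finset.range (n + 1), (-1) ^ l * (n.descFactorial l : ℝ) *
          (Real.log 2 ^ (n - l) * zetaVal (l + 2)) := by
    simp only [hF]
    rw [one_add_one_eq_two, div_self two_ne_zero]
    congr 1
    · ring
    · exact Finset.sum_congr rfl fun l _ => by rw [polyLog_at_one (by omega)]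
  have h0 : F 0 = -((-1) ^ n * n.factorial * polyLog (n + 2) (1 / 2)) := by
    simp only [hF]
    rw [Finset.sum_range_succ, Finset.sum_eq_zero]
    -- At x = 0 the logarithm vanishes, so only l = n, with exponent zero, survives.
    · simp [Nat.descFactorial_self]
    · intro l hl
      have : n - l ≠ 0 := by have := Finset.mem_range.1 hl; omega
      simp [this]
  rw [logIntegral, h, h1, h0]
  ring

lemma logIntegral_zero : logIntegral 0 = (Real.log 2 ^ 2 - zetaVal 2) / 2 := by
  rw [logIntegral_eq]
  simp only [zero_add, Finset.sum_range_one]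
  rw [polyLog_two_half]
  norm_num
  ring

/-- Since C(n,r) C(r,l) = C(n,l) C(n-l,r-l), this is an alternating row sum of Pascal's triangle. -/
lemma sum_neg_one_pow_mul_choose_mul_choose {n l : ℕ} (hl : l ≤ n) :
    ∑ r ∈ Finset.range (n + 1), (-1 : ℝ) ^ r * (n.choose r * r.choose l) =
      if l = n then (-1) ^ n else 0 := by
  obtain ⟨d, rfl⟩ := Nat.exists_eq_add_of_le hl
  rw [add_assoc, Finset.sum_range_add, Finset.sum_eq_zero, zero_add]
  · have h : ∀ j ∈ Finset.range (d + 1),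
        (-1 : ℝ) ^ (l + j) * (((l + d).choose (l + j) : ℝ) * (l + j).choose l) =
        (-1) ^ l * (l + d).choose l * ((-1) ^ j * d.choose j) := by
      intro j hj
      have hj' : j ≤ d := Nat.lt_succ_iff.1 (Finset.mem_range.1 hj)
      have hc := Nat.choose_mul (n := l + d) (k := l + j) (s := l) (by omega)
      rw [Nat.add_sub_cancel_left, Nat.add_sub_cancel_left] at hc
      have hc' : ((l + d).choose (l + j) : ℝ) * (l + j).choose l = (l + d).choose l * d.choose j := by
        exact_mod_cast hc
      rw [hc', pow_add]
      ring
    rw [Finset.sum_congr rfl h, ← Finset.mul_sum]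
    have ha : ∑ j ∈ Finset.range (d + 1), (-1 : ℝ) ^ j * d.choose j = if d = 0 then 1 else 0 := by
      exact_mod_cast Int.alternating_sum_range_choose (n := d)
    rw [ha]
    rcases Nat.eq_zero_or_pos d with rfl | hd
    · simp
    · simp [hd.ne']
  · intro r hr
    rw [Nat.choose_eq_zero_of_lt (Finset.mem_range.1 hr)]
    simp

/-- After exchanging the sums, binomial orthogonality leaves only l = n. This reconciles the stated
double sum with `logIntegral_eq`. -/
lemma sum_choose_mul_sum_factorial_mul_choose {n : ℕ} (hn : 1 ≤ n) (X : ℕ → ℝ) :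
    ∑ r ∈ Finset.Icc 1 n, (n.choose r : ℝ) * (-1 : ℝ) ^ (r + 1) *
        ∑ l ∈ Finset.Icc 1 r, (l.factorial : ℝ) * (r.choose l : ℝ) * X l =
      (-1) ^ (n + 1) * n.factorial * X n := by
  have hinner : ∀ r ∈ Finset.Icc 1 n,
      ∑ l ∈ Finset.Icc 1 r, (l.factorial : ℝ) * (r.choose l : ℝ) * X l =
      ∑ l ∈ Finset.Icc 1 n, (l.factorial : ℝ) * (r.choose l : ℝ) * X l := by
    intro r hr
    refine Finset.sum_subset (Finset.Icc_subset_Icc_right (Finset.mem_Icc.1 hr).2) ?_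
    intro l hl hlr
    have : r < l := by
      simp only [Finset.mem_Icc] at hl hlr
      omega
    simp [Nat.choose_eq_zero_of_lt this]
  rw [Finset.sum_congr rfl fun r hr => by rw [hinner r hr]]
  simp_rw [Finset.mul_sum]
  rw [Finset.sum_comm]
  have houter : ∀ l ∈ Finset.Icc 1 n,
      ∑ r ∈ Finset.Icc 1 n, (n.choose r : ℝ) * (-1 : ℝ) ^ (r + 1) *
        ((l.factorial : ℝ) * (r.choose l : ℝ) * X l) =
      if l = n then (-1) ^ (n + 1) * n.factorial * X n else 0 := by
    intro l hl
    have hl' := Finset.mem_Icc.1 hl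
    have h := sum_neg_one_pow_mul_choose_mul_choose hl'.2
    -- The term r = 0 is absent from the sum at hand; it vanishes because l ≥ 1.
    rw [Finset.sum_range_eq_add_Ico _ (by omega), Finset.Ico_add_one_right_eq_Icc,
      Nat.choose_eq_zero_of_lt (n := 0) (by omega : 0 < l)] at h
    simp only [Nat.cast_zero, mul_zero, zero_add] at h
    calc _ = -(l.factorial * X l) *
          ∑ r ∈ Finset.Icc 1 n, (-1 : ℝ) ^ r * (n.choose r * r.choose l) := by
          rw [Finset.mul_sum]
          exact Finset.sum_congr rfl fun r _ => by ring
      _ = _ := by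
          rw [h]
          split_ifs with hln
          · rw [hln]; ring
          · simp
  rw [Finset.sum_congr rfl houter, Finset.sum_ite_eq' (Finset.Icc 1 n) n]
  simp [hn]

lemma logIntegral_eq_sum_choose {n : ℕ} (hn : 1 ≤ n) :
    logIntegral n =
      1 / ((n : ℝ) + 1) * Real.log 2 ^ (n + 2) - zetaVal 2 * Real.log 2 ^ n
        - ∑ r ∈ Finset.Icc 1 n, (n.choose r : ℝ) * (-1 : ℝ) ^ (r + 1) *
            ((∑ l ∈ Finset.Icc 1 r, (l.factorial : ℝ) * (r.choose l : ℝ) *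
                Real.log 2 ^ (n - l) * polyLog (l + 2) (1 / 2))
              - (r.factorial : ℝ) * Real.log 2 ^ (n - r) * zetaVal (r + 2)) := by
  have h := sum_choose_mul_sum_factorial_mul_choose hn
    fun l => Real.log 2 ^ (n - l) * polyLog (l + 2) (1 / 2)
  simp only [← mul_assoc] at h
  simp_rw [mul_sub]
  rw [Finset.sum_sub_distrib, h, logIntegral_eq, Finset.sum_range_eq_add_Ico _ (by omega),
    Finset.Ico_add_one_right_eq_Icc]
  have hz : ∑ r ∈ Finset.Icc 1 n, (n.choose r : ℝ) * (-1 : ℝ) ^ (r + 1) *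
        ((r.factorial : ℝ) * Real.log 2 ^ (n - r) * zetaVal (r + 2)) =
      -∑ l ∈ Finset.Icc 1 n, (-1) ^ l * (n.descFactorial l : ℝ) *
          (Real.log 2 ^ (n - l) * zetaVal (l + 2)) := by
    rw [← Finset.sum_neg_distrib]
    refine Finset.sum_congr rfl fun r _ => ?_
    rw [Nat.descFactorial_eq_factorial_mul_choose]
    push_cast
    ring
  rw [hz]
  simp
  ring

/-! ### Rational linear combinations -/

lemma ratCast_mul_mem_span {S : Set ℝ} (q : ℚ) {x : ℝ} (hx : x ∈ Submodule.span ℚ S) :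
    (q : ℝ) * x ∈ Submodule.span ℚ S := by
  rw [← Rat.smul_def]
  exact Submodule.smul_mem _ q hx

/-- The generating set is itself stable under multiplication by powers of ln 2. -/
lemma log_two_pow_mul_mem_span (a : ℕ) {x : ℝ} (hx : x ∈ Submodule.span ℚ zetaPolylogTerms) :
    Real.log 2 ^ a * x ∈ Submodule.span ℚ zetaPolylogTerms := by
  induction hx using Submodule.span_induction with
  | mem x hx =>
    refine Submodule.subset_span ?_
    obtain ⟨b, rfl | ⟨j, hj, rfl | rfl⟩⟩ := hx
    · exact ⟨a + b, Or.inl (pow_add _ _ _).symm⟩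
    · exact ⟨a + b, Or.inr ⟨j, hj, Or.inl (by ring)⟩⟩
    · exact ⟨a + b, Or.inr ⟨j, hj, Or.inr (by ring)⟩⟩
  | zero => simp
  | add x y _ _ hx hy => rw [mul_add]; exact add_mem hx hy
  | smul q x _ hx => rw [mul_smul_comm]; exact Submodule.smul_mem _ q hx

lemma logIntegral_mem_span (n : ℕ) : logIntegral n ∈ Submodule.span ℚ zetaPolylogTerms := by
  rw [logIntegral_eq]
  refine add_mem (sub_mem ?_ (sum_mem fun l _ => ?_)) ?_
  · have h := ratCast_mul_mem_span (1 / ((n : ℚ) + 1))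
      (Submodule.subset_span (s := zetaPolylogTerms) ⟨n + 2, Or.inl rfl⟩)
    push_cast at h
    rwa [one_div_mul_eq_div] at h
  · have h := ratCast_mul_mem_span ((-1) ^ l * (n.descFactorial l : ℚ))
      (Submodule.subset_span (s := zetaPolylogTerms)
        ⟨n - l, Or.inr ⟨l + 2, by omega, Or.inl rfl⟩⟩)
    push_cast at h
    exact h
  · have h := ratCast_mul_mem_span ((-1) ^ n * (n.factorial : ℚ))
      (Submodule.subset_span (s := zetaPolylogTerms)
        ⟨0, Or.inr ⟨n + 2, by omega, Or.inr rfl⟩⟩)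
    push_cast at h
    rwa [pow_zero, one_mul] at h

lemma mzv_barIndex_mem_span (m k : ℕ) :
    mzv (barIndex m k) ∈ Submodule.span ℚ zetaPolylogTerms := by
  induction m using Nat.strong_induction_on with
  | _ m ih =>
    rw [mzv_barIndex_recurrence]
    refine sub_mem ?_ (sum_mem fun i hi => ?_)
    · have h1 := ratCast_mul_mem_span ((k : ℚ) + 1)
        (log_two_pow_mul_mem_span (m + 1) (logIntegral_mem_span k))
      have h2 := ratCast_mul_mem_span ((m : ℚ) + k + 2) (logIntegral_mem_span (m + k + 1))
      have h := ratCast_mul_mem_span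
        ((-1) ^ k / (((m + 1).factorial : ℚ) * ((k + 1).factorial : ℚ))) (sub_mem h1 h2)
      push_cast at h
      rwa [← mul_assoc ((k : ℝ) + 1)] at h
    · have hi' := Finset.mem_Icc.1 hi
      have h := ratCast_mul_mem_span (1 / (i.factorial : ℚ))
        (log_two_pow_mul_mem_span i (ih (m - i) (by omega)))
      push_cast at h
      rwa [← mul_assoc, one_div_mul_eq_div] at h

theorem theorem3p5 (m k : ℕ) :
    -- the series defining the multiple zeta value converges
    Tendsto (mzvPartial (barIndex m k)) atTop (𝓝 (mzv (barIndex m k))) ∧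
    -- the integrals `I(n)` exist
    (∀ n : ℕ, IntervalIntegrable (logIntegrand n) MeasureTheory.volume 0 1) ∧
    -- the recurrence
    mzv (barIndex m k) =
      (-1 : ℝ) ^ k / (((m + 1).factorial : ℝ) * ((k + 1).factorial : ℝ)) *
          (((k : ℝ) + 1) * Real.log 2 ^ (m + 1) * logIntegral k
            - ((m : ℝ) + (k : ℝ) + 2) * logIntegral (m + k + 1))
        - ∑ i ∈ Finset.Icc 1 m,
            Real.log 2 ^ i / (i.factorial : ℝ) * mzv (barIndex (m - i) k) ∧
    -- the evaluation of `I(n)`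
    logIntegral 0 = (Real.log 2 ^ 2 - zetaVal 2) / 2 ∧
    (∀ n : ℕ, 1 ≤ n →
      logIntegral n =
        1 / ((n : ℝ) + 1) * Real.log 2 ^ (n + 2) - zetaVal 2 * Real.log 2 ^ n
          - ∑ r ∈ Finset.Icc 1 n, (n.choose r : ℝ) * (-1 : ℝ) ^ (r + 1) *
              ((∑ l ∈ Finset.Icc 1 r, (l.factorial : ℝ) * (r.choose l : ℝ) *
                  Real.log 2 ^ (n - l) * polyLog (l + 2) (1 / 2))
                - (r.factorial : ℝ) * Real.log 2 ^ (n - r) * zetaVal (r + 2))) ∧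
    -- the multiple zeta value in terms of zeta values, polylogarithms at `1/2` and `ln 2`
    mzv (barIndex m k) ∈ Submodule.span ℚ zetaPolylogTerms := by
  exact ⟨tendsto_mzvPartial_barIndex m k, intervalIntegrable_logIntegrand,
    mzv_barIndex_recurrence m k, logIntegral_zero, fun _ hn => logIntegral_eq_sum_choose hn,
    mzv_barIndex_mem_span m k⟩
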